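/- Let $\mathbf{k}$ be a field, $G$ a finite abelian group, $g_1,\dots,g_n\in G$, let $\chi_1,\dots,\chi_n\colon G\to\mathbf{k}^\times$ be characters, and put $q_{ij}=\chi_j(g_i)$. Let $V$ be the vector space with basis $x_1,\dots,x_n$, braiding $c(x_i\otimes x_j)=q_{ij}\,x_j\otimes x_i$, $G$-action $a\cdot x_i=\chi_i(a)x_i$ and $G$-coaction $x_i\mapsto g_i\otimes x_i$. Its Nichols algebra $\mathfrak{B}(V)$ is the quotient of the tensor algebra $T(V)$ (with the braided comultiplication for which the $x_i$ are primitive) by the largest two-sided ideal that is spanned by homogeneous elements of degree $\ge 2$, is stable under the action and the coaction of $G$, and is a coideal. Assume that $\mathfrak{B}(V)$ is finite-dimensional, and let $H=\mathfrak{B}(V)\#\mathbf{k}G$ be its bosonization, that is, $a x_i=\chi_i(a)x_i a$ and $\Delta(a)=a\otimes a$ for $a\in G$, and $\Delta(x_i)=g_i\otimes x_i+x_i\otimes 1$. Let $\varphi\in H^*$ be a nonzero right integral ($\varphi\psi=\psi(1)\varphi$ for all $\psi\in H^*$), and let $\rho$ be the Nakayama automorphism of $H$ with respect to $\varphi$,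 i.e. the algebra automorphism with $\varphi(yx)=\varphi(\rho(x)y)$ for all $x,y\in H$. Let $t\in H$ be a nonzero right integral ($th=\varepsilon(h)t$ for all $h\in H$), and let $\alpha\colon H\to\mathbf{k}$ be the modular function, i.e. the algebra map with $ht=\alpha(h)t$ for all $h\in H$. Put $$L_2=\alpha(G)\quad\text{and}\quad L_1=\langle q_{11},\dots,q_{nn},\alpha(G)\rangle\le\mathbf{k}^\times,\qquad H_\omega=\{h\in H:\rho(h)=\omega h\}\quad(\omega\in L_1).$$ Then $H=\bigoplus_{\omega\in L_1}H_\omega$, and the following are equivalent: 1. this decomposition is strongly graded, i.e. $H_\omega H_\tau=H_{\omega\tau}$ for all $\omega,\tau\in L_1$; 2. $L_1=L_2$; 3. each $H_\omega$, $\omega\in L_1$, contains an element of $G$; 4. $H$ is a crossed product $H_1\ltimes\mathbf{k}L_1$: there are a weak action of $L_1$ on $H_1$, a normalized two-cocycle $\sigma\colon L_1\times L_1\to H_1^\times$ for it, and an algebra isomorphism from $H_1\ltimes_\sigma\mathbf{k}L_1$ (with product $(a\ltimes\omega)(b\ltimes\tau)=a(\omega\cdot b)\sigma(\omega,\tau)\ltimes\omega\tau$)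 onto $H$ that is the identity on $H_1$ and maps $H_1\ltimes\omega$ into $H_\omega$ for every $\omega\in L_1$. -/

import Mathlib

open scoped TensorProduct

noncomputable section

namespace NicholsDiag

section Defs

variable {k : Type*} [Field k] {G : Type*} [CommGroup G] {n : ℕ}

/-- The action of `a : G` on the tensor algebra `T(V)` (the free algebra on the basis
`x₁, …, xₙ` of `V`) by algebra automorphisms: `a · xᵢ = χᵢ(a) xᵢ`. -/
def gAct (χ : Fin n → G →* kˣ) (a : G) : FreeAlgebra k (Fin n) →ₐ[k] FreeAlgebra k (Fin n) :=
  FreeAlgebra.lift k fun i => (χ i a : k) • FreeAlgebra.ι k i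

/-- The coaction of `kG` on `T(V)`, the algebra map with `xᵢ ↦ gᵢ ⊗ xᵢ`. -/
def gCoact (g : Fin n → G) :
    FreeAlgebra k (Fin n) →ₐ[k] MonoidAlgebra k G ⊗[k] FreeAlgebra k (Fin n) :=
  FreeAlgebra.lift k fun i => MonoidAlgebra.of k G (g i) ⊗ₜ[k] FreeAlgebra.ι k i

/-- Left multiplication by `xᵢ ⊗ 1 + 1 ⊗ xᵢ` in the braided tensor square of `T(V)`, where
`(1 ⊗ xᵢ) (a ⊗ b) = (gᵢ · a) ⊗ xᵢ b`, because the braiding moves `xᵢ` past `xⱼ` at the cost of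
the factor `qᵢⱼ = χⱼ(gᵢ)`. -/
def primMul (g : Fin n → G) (χ : Fin n → G →* kˣ) (i : Fin n) :
    Module.End k (FreeAlgebra k (Fin n) ⊗[k] FreeAlgebra k (Fin n)) :=
  TensorProduct.map (LinearMap.mulLeft k (FreeAlgebra.ι k i)) LinearMap.id +
    TensorProduct.map (gAct χ (g i)).toLinearMap (LinearMap.mulLeft k (FreeAlgebra.ι k i))

/-- The braided comultiplication of `T(V)`: the multiplicative map into the braided tensor square
for which all `xᵢ` are primitive, so `Δ(xᵢ f) = (xᵢ ⊗ 1 + 1 ⊗ xᵢ) Δ(f)` and `Δ(1) = 1 ⊗ 1`. -/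
def braidedComul (g : Fin n → G) (χ : Fin n → G →* kˣ) :
    FreeAlgebra k (Fin n) →ₗ[k] FreeAlgebra k (Fin n) ⊗[k] FreeAlgebra k (Fin n) :=
  (LinearMap.applyₗ (1 ⊗ₜ[k] 1)).comp (FreeAlgebra.lift k (primMul g χ)).toLinearMap

/-- The homogeneous component of degree `m` of `T(V)`. -/
def tDeg (k : Type*) [Field k] (n m : ℕ) : Submodule k (FreeAlgebra k (Fin n)) :=
  Submodule.span k (Set.range (FreeAlgebra.ι k)) ^ m

/-- The two-sided ideals of `T(V)` that are spanned by homogeneous elements of degree at least two,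
are Yetter-Drinfeld submodules, and are coideals for the braided comultiplication. -/
structure IsBraidedBiideal (g : Fin n → G) (χ : Fin n → G →* kˣ)
    (I : Ideal (FreeAlgebra k (Fin n))) : Prop where
  twoSided : I.IsTwoSided
  homogeneous : I.restrictScalars k ≤
    ⨆ m : {m : ℕ // 2 ≤ m}, I.restrictScalars k ⊓ tDeg k n m
  act_mem : ∀ a : G, ∀ f ∈ I, gAct χ a f ∈ I
  coact_mem : ∀ f ∈ I, gCoact (k := k) g f ∈
    LinearMap.range ((I.restrictScalars k).subtype.lTensor (MonoidAlgebra k G))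
  comul_mem : ∀ f ∈ I, braidedComul g χ f ∈
    LinearMap.range ((I.restrictScalars k).subtype.rTensor (FreeAlgebra k (Fin n))) ⊔
    LinearMap.range ((I.restrictScalars k).subtype.lTensor (FreeAlgebra k (Fin n)))

/-- The defining ideal of the Nichols algebra: the sum of all the ideals as above. -/
def nicholsIdeal (g : Fin n → G) (χ : Fin n → G →* kˣ) : Ideal (FreeAlgebra k (Fin n)) :=
  sSup {I | IsBraidedBiideal g χ I}

theorem nicholsIdeal_induction (g : Fin n → G) (χ : Fin n → G →* kˣ)
    {p : FreeAlgebra k (Fin n) → Prop}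
    (mem : ∀ I, IsBraidedBiideal g χ I → ∀ f ∈ I, p f) (zero : p 0)
    (add : ∀ f f', p f → p f' → p (f + f')) {f : FreeAlgebra k (Fin n)}
    (hf : f ∈ nicholsIdeal g χ) : p f := by
  unfold nicholsIdeal at hf
  rw [sSup_eq_iSup'] at hf
  exact Submodule.iSup_induction _ (motive := p) hf (fun I x hx => mem I.1 I.2 x hx) zero add

theorem le_nicholsIdeal {g : Fin n → G} {χ : Fin n → G →* kˣ} {I : Ideal (FreeAlgebra k (Fin n))}
    (hI : IsBraidedBiideal g χ I) : I ≤ nicholsIdeal g χ :=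
  le_sSup hI

instance (g : Fin n → G) (χ : Fin n → G →* kˣ) : (nicholsIdeal g χ).IsTwoSided where
  mul_mem_of_left b hf := by
    refine nicholsIdeal_induction g χ (p := fun f => f * b ∈ nicholsIdeal g χ) ?_ ?_ ?_ hf
    · intro I hI f hf
      have := hI.twoSided
      exact le_nicholsIdeal hI (I.mul_mem_right b hf)
    · simp
    · intro f f' h h'
      rw [add_mul]
      exact add_mem h h'

theorem gAct_mem (g : Fin n → G) (χ : Fin n → G →* kˣ) (a : G) {f : FreeAlgebra k (Fin n)}
    (hf : f ∈ nicholsIdeal g χ) : gAct χ a f ∈ nicholsIdeal g χ := by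
  refine nicholsIdeal_induction g χ (p := fun f => gAct χ a f ∈ nicholsIdeal g χ) ?_ ?_ ?_ hf
  · intro I hI f hf
    exact le_nicholsIdeal hI (hI.act_mem a f hf)
  · simp
  · intro f f' h h'
    rw [map_add]
    exact add_mem h h'

/-- The Nichols algebra `𝔅(V)` of the braided vector space `V` with basis `x₁, …, xₙ` and
braiding `c(xᵢ ⊗ xⱼ) = χⱼ(gᵢ) xⱼ ⊗ xᵢ`. -/
def Nichols (g : Fin n → G) (χ : Fin n → G →* kˣ) : Type _ :=
  FreeAlgebra k (Fin n) ⧸ nicholsIdeal g χ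

instance (g : Fin n → G) (χ : Fin n → G →* kˣ) : Ring (Nichols g χ) :=
  inferInstanceAs (Ring (FreeAlgebra k (Fin n) ⧸ nicholsIdeal g χ))

instance (g : Fin n → G) (χ : Fin n → G →* kˣ) : Algebra k (Nichols g χ) :=
  inferInstanceAs (Algebra k (FreeAlgebra k (Fin n) ⧸ nicholsIdeal g χ))

/-- The projection `T(V) → 𝔅(V)`. -/
def toNichols (g : Fin n → G) (χ : Fin n → G →* kˣ) : FreeAlgebra k (Fin n) →ₐ[k] Nichols g χ :=
  Ideal.Quotient.mkₐ k (nicholsIdeal g χ)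

theorem toNichols_surjective (g : Fin n → G) (χ : Fin n → G →* kˣ) :
    Function.Surjective (toNichols g χ) :=
  Ideal.Quotient.mk_surjective

theorem toNichols_eq_zero (g : Fin n → G) (χ : Fin n → G →* kˣ) {f : FreeAlgebra k (Fin n)}
    (hf : f ∈ nicholsIdeal g χ) : toNichols g χ f = 0 :=
  Ideal.Quotient.eq_zero_iff_mem.2 hf

/-- Algebra maps out of `𝔅(V)`. -/
def Nichols.lift (g : Fin n → G) (χ : Fin n → G →* kˣ) {B : Type*} [Semiring B] [Algebra k B]
    (f : FreeAlgebra k (Fin n) →ₐ[k] B) (hf : ∀ a ∈ nicholsIdeal g χ, f a = 0) :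
    Nichols g χ →ₐ[k] B :=
  Ideal.Quotient.liftₐ (nicholsIdeal g χ) f hf

@[simp]
theorem Nichols.lift_toNichols (g : Fin n → G) (χ : Fin n → G →* kˣ) {B : Type*} [Semiring B]
    [Algebra k B] (f : FreeAlgebra k (Fin n) →ₐ[k] B) (hf : ∀ a ∈ nicholsIdeal g χ, f a = 0)
    (a : FreeAlgebra k (Fin n)) : Nichols.lift g χ f hf (toNichols g χ a) = f a :=
  rfl

theorem Nichols.algHom_ext {g : Fin n → G} {χ : Fin n → G →* kˣ} {B : Type*} [Semiring B]
    [Algebra k B] {f f' : Nichols g χ →ₐ[k] B}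
    (h : ∀ i, f (toNichols g χ (FreeAlgebra.ι k i)) = f' (toNichols g χ (FreeAlgebra.ι k i))) :
    f = f' := by
  have : f.comp (toNichols g χ) = f'.comp (toNichols g χ) := by
    ext i
    exact h i
  ext a
  obtain ⟨a, rfl⟩ := toNichols_surjective g χ a
  exact congr($this a)

/-- The action of `a : G` on `𝔅(V)`. -/
def Nichols.act (g : Fin n → G) (χ : Fin n → G →* kˣ) (a : G) : Nichols g χ →ₐ[k] Nichols g χ :=
  Nichols.lift g χ ((toNichols g χ).comp (gAct χ a))
    fun _ hf => toNichols_eq_zero g χ (gAct_mem g χ a hf)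

theorem Nichols.act_x (g : Fin n → G) (χ : Fin n → G →* kˣ) (a : G) (i : Fin n) :
    Nichols.act g χ a (toNichols g χ (FreeAlgebra.ι k i)) =
      (χ i a : k) • toNichols g χ (FreeAlgebra.ι k i) := by
  simp [Nichols.act, gAct]

instance (g : Fin n → G) (χ : Fin n → G →* kˣ) : MulSemiringAction G (Nichols g χ) where
  smul a := Nichols.act g χ a
  one_smul b := by
    have : Nichols.act g χ 1 = AlgHom.id k _ := Nichols.algHom_ext fun i => by
      simp [Nichols.act_x]
    exact congr($this b)
  mul_smul a a' b := by
    have : Nichols.act g χ (a * a') = (Nichols.act g χ a).comp (Nichols.act g χ a') :=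
      Nichols.algHom_ext fun i => by
        simp [Nichols.act_x, smul_smul, mul_comm]
    exact congr($this b)
  smul_zero a := map_zero (Nichols.act g χ a)
  smul_add a := map_add (Nichols.act g χ a)
  smul_one a := map_one (Nichols.act g χ a)
  smul_mul a := map_mul (Nichols.act g χ a)

theorem Nichols.smul_def (g : Fin n → G) (χ : Fin n → G →* kˣ) (a : G) (b : Nichols g χ) :
    a • b = Nichols.act g χ a b :=
  rfl

instance (g : Fin n → G) (χ : Fin n → G →* kˣ) : SMulCommClass G k (Nichols g χ) where
  smul_comm a c b := map_smul (Nichols.act g χ a) c b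

/-- The bosonization `H = 𝔅(V) # kG`: the free `𝔅(V)`-module on `G` with the product
`(r # a) (s # b) = r (a · s) # a b`. -/
abbrev Bos (g : Fin n → G) (χ : Fin n → G →* kˣ) : Type _ :=
  SkewMonoidAlgebra (Nichols g χ) G

/-- The embedding `𝔅(V) → H`. -/
def ofNichols (g : Fin n → G) (χ : Fin n → G →* kˣ) : Nichols g χ →ₐ[k] Bos g χ where
  __ := SkewMonoidAlgebra.singleOneRingHom (k := Nichols g χ) (G := G)
  commutes' _ := rfl

/-- The embedding `G → H`. -/
def ofG (g : Fin n → G) (χ : Fin n → G →* kˣ) : G →* Bos g χ :=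
  SkewMonoidAlgebra.of (Nichols g χ) G

/-- The generators `xᵢ` of `H`. -/
def genX (g : Fin n → G) (χ : Fin n → G →* kˣ) (i : Fin n) : Bos g χ :=
  ofNichols g χ (toNichols g χ (FreeAlgebra.ι k i))

theorem ofG_mul_ofNichols (g : Fin n → G) (χ : Fin n → G →* kˣ) (a : G) (r : Nichols g χ) :
    ofG g χ a * ofNichols g χ r = ofNichols g χ (a • r) * ofG g χ a := by
  change SkewMonoidAlgebra.of (Nichols g χ) G a * SkewMonoidAlgebra.single 1 r =
    SkewMonoidAlgebra.single 1 (a • r) * SkewMonoidAlgebra.of (Nichols g χ) G a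
  simp

theorem single_eq (g : Fin n → G) (χ : Fin n → G →* kˣ) (a : G) (r : Nichols g χ) :
    SkewMonoidAlgebra.single a r = ofNichols g χ r * ofG g χ a := by
  change _ = SkewMonoidAlgebra.single 1 r * SkewMonoidAlgebra.of (Nichols g χ) G a
  simp

theorem ofG_mul_genX (g : Fin n → G) (χ : Fin n → G →* kˣ) (a : G) (i : Fin n) :
    ofG g χ a * genX g χ i = (χ i a : k) • (genX g χ i * ofG g χ a) := by
  rw [genX, ofG_mul_ofNichols, Nichols.smul_def, Nichols.act_x, map_smul, smul_mul_assoc]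

theorem Bos.algHom_ext {g : Fin n → G} {χ : Fin n → G →* kˣ} {B : Type*} [Semiring B]
    [Algebra k B] {f f' : Bos g χ →ₐ[k] B}
    (hG : ∀ a, f (ofG g χ a) = f' (ofG g χ a)) (hx : ∀ i, f (genX g χ i) = f' (genX g χ i)) :
    f = f' := by
  have h : f.comp (ofNichols g χ) = f'.comp (ofNichols g χ) := Nichols.algHom_ext hx
  apply AlgHom.toLinearMap_injective
  refine SkewMonoidAlgebra.lhom_ext fun a r => ?_
  rw [single_eq, AlgHom.toLinearMap_apply, AlgHom.toLinearMap_apply, map_mul, map_mul, hG]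
  exact congr($h r * _)

/-- Algebra maps out of `H`. -/
def Bos.lift (g : Fin n → G) (χ : Fin n → G →* kˣ) {B : Type*} [Semiring B] [Algebra k B]
    (f : Nichols g χ →ₐ[k] B) (u : G →* B)
    (h : ∀ a i, u a * f (toNichols g χ (FreeAlgebra.ι k i)) =
      (χ i a : k) • (f (toNichols g χ (FreeAlgebra.ι k i)) * u a)) : Bos g χ →ₐ[k] B :=
  SkewMonoidAlgebra.liftNCAlgHom f u (by
    intro r a
    obtain ⟨r, rfl⟩ := toNichols_surjective g χ r
    rw [Nichols.smul_def]
    induction r using FreeAlgebra.induction with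
    | grade0 c => simp [Algebra.commutes]
    | grade1 i => simp [Nichols.act_x, h]
    | mul r s hr hs =>
      rw [map_mul, map_mul, map_mul, map_mul, mul_assoc, hs, ← mul_assoc, hr, mul_assoc]
    | add r s hr hs =>
      rw [map_add, map_add, map_add, map_add, add_mul, mul_add, hr, hs])

theorem Bos.lift_ofNichols (g : Fin n → G) (χ : Fin n → G →* kˣ) {B : Type*} [Semiring B]
    [Algebra k B] (f : Nichols g χ →ₐ[k] B) (u : G →* B) (h) (r : Nichols g χ) :
    Bos.lift g χ f u h (ofNichols g χ r) = f r := by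
  change SkewMonoidAlgebra.liftNC (f : Nichols g χ →+ B) u (SkewMonoidAlgebra.single 1 r) = f r
  simp

theorem Bos.lift_ofG (g : Fin n → G) (χ : Fin n → G →* kˣ) {B : Type*} [Semiring B]
    [Algebra k B] (f : Nichols g χ →ₐ[k] B) (u : G →* B) (h) (a : G) :
    Bos.lift g χ f u h (ofG g χ a) = u a := by
  change SkewMonoidAlgebra.liftNC (f : Nichols g χ →+ B) u (SkewMonoidAlgebra.of _ G a) = u a
  simp

/-! The comultiplication of `H`. -/

/-- The algebra map `T(V) → H ⊗ H` with `xᵢ ↦ gᵢ ⊗ xᵢ + xᵢ ⊗ 1`. -/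
def comulT (g : Fin n → G) (χ : Fin n → G →* kˣ) :
    FreeAlgebra k (Fin n) →ₐ[k] Bos g χ ⊗[k] Bos g χ :=
  FreeAlgebra.lift k fun i => ofG g χ (g i) ⊗ₜ[k] genX g χ i + genX g χ i ⊗ₜ[k] 1

/-- The algebra map `T(V) → H ⊗ H` with `xᵢ ↦ gᵢ ⊗ xᵢ`. -/
def coactT (g : Fin n → G) (χ : Fin n → G →* kˣ) :
    FreeAlgebra k (Fin n) →ₐ[k] Bos g χ ⊗[k] Bos g χ :=
  FreeAlgebra.lift k fun i => ofG g χ (g i) ⊗ₜ[k] genX g χ i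

/-- The map `T(V) ⊗ T(V) → H ⊗ H` with `a ⊗ b ↦ a b₍₋₁₎ ⊗ b₍₀₎`. -/
def bosT (g : Fin n → G) (χ : Fin n → G →* kˣ) :
    FreeAlgebra k (Fin n) ⊗[k] FreeAlgebra k (Fin n) →ₗ[k] Bos g χ ⊗[k] Bos g χ :=
  (LinearMap.mul' k (Bos g χ ⊗[k] Bos g χ)).comp (TensorProduct.map
    ((Algebra.TensorProduct.includeLeft.comp (ofNichols g χ)).comp (toNichols g χ)).toLinearMap
    (coactT g χ).toLinearMap)

theorem bosT_tmul (g : Fin n → G) (χ : Fin n → G →* kˣ) (a b : FreeAlgebra k (Fin n)) :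
    bosT g χ (a ⊗ₜ b) = (ofNichols g χ (toNichols g χ a) ⊗ₜ 1) * coactT g χ b :=
  rfl

theorem bosT_primMul (g : Fin n → G) (χ : Fin n → G →* kˣ) (i : Fin n)
    (z : FreeAlgebra k (Fin n) ⊗[k] FreeAlgebra k (Fin n)) :
    bosT g χ (primMul g χ i z) =
      (ofG g χ (g i) ⊗ₜ[k] genX g χ i + genX g χ i ⊗ₜ[k] 1) * bosT g χ z := by
  induction z with
  | zero => simp
  | add y z hy hz => rw [map_add, map_add, map_add, hy, hz, mul_add]
  | tmul a b =>
    have h1 : coactT g χ (FreeAlgebra.ι k i * b) =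
        (ofG g χ (g i) ⊗ₜ[k] genX g χ i) * coactT g χ b := by
      simp [coactT]
    have h2 : ofNichols g χ (toNichols g χ (gAct χ (g i) a)) * ofG g χ (g i) =
        ofG g χ (g i) * ofNichols g χ (toNichols g χ a) := by
      rw [ofG_mul_ofNichols]
      rfl
    have h3 : primMul g χ i (a ⊗ₜ[k] b) = (FreeAlgebra.ι k i * a) ⊗ₜ[k] b +
        gAct χ (g i) a ⊗ₜ[k] (FreeAlgebra.ι k i * b) := rfl
    rw [h3, map_add, bosT_tmul, bosT_tmul, bosT_tmul, h1, map_mul, map_mul, ← mul_assoc,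
      Algebra.TensorProduct.tmul_mul_tmul, h2, one_mul, add_mul, add_comm, ← mul_assoc, ← mul_assoc,
      Algebra.TensorProduct.tmul_mul_tmul, Algebra.TensorProduct.tmul_mul_tmul, mul_one, mul_one]
    rfl

theorem comulT_eq (g : Fin n → G) (χ : Fin n → G →* kˣ) (f : FreeAlgebra k (Fin n)) :
    comulT g χ f = bosT g χ (braidedComul g χ f) := by
  have key : ∀ z, bosT g χ (FreeAlgebra.lift k (primMul g χ) f z) = comulT g χ f * bosT g χ z := by
    induction f using FreeAlgebra.induction with
    | grade0 c => intro z; simp [Algebra.algebraMap_eq_smul_one]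
    | grade1 i => intro z; simp [comulT, bosT_primMul]
    | mul r s hr hs =>
      intro z
      rw [map_mul, map_mul, Module.End.mul_apply, hr, hs, mul_assoc]
    | add r s hr hs =>
      intro z
      rw [map_add, map_add, LinearMap.add_apply, map_add, hr, hs, add_mul]
  have := key (1 ⊗ₜ 1)
  rw [bosT_tmul, map_one, map_one, map_one, mul_one] at this
  rw [← Algebra.TensorProduct.one_def (A := Bos g χ), mul_one] at this
  exact this.symm

theorem coactT_eq_zero (g : Fin n → G) (χ : Fin n → G →* kˣ) {I : Ideal (FreeAlgebra k (Fin n))}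
    (hI : IsBraidedBiideal g χ I) {f : FreeAlgebra k (Fin n)} (hf : f ∈ I) :
    coactT g χ f = 0 := by
  let u : MonoidAlgebra k G →ₐ[k] Bos g χ := MonoidAlgebra.lift k _ G (ofG g χ)
  let p : FreeAlgebra k (Fin n) →ₐ[k] Bos g χ := (ofNichols g χ).comp (toNichols g χ)
  have h : coactT g χ = (Algebra.TensorProduct.map u p).comp (gCoact g) := by
    ext i
    simp [coactT, gCoact, u, p, genX]
  obtain ⟨y, hy⟩ := hI.coact_mem f hf
  rw [h, AlgHom.comp_apply, ← hy]
  clear hy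
  induction y with
  | zero => simp
  | add y z hy hz => rw [map_add, map_add, hy, hz, add_zero]
  | tmul a b =>
    have : p b = 0 := by
      change ofNichols g χ (toNichols g χ b) = 0
      rw [toNichols_eq_zero g χ (le_nicholsIdeal hI b.2), map_zero]
    simp [this]

theorem comulT_eq_zero (g : Fin n → G) (χ : Fin n → G →* kˣ) (f : FreeAlgebra k (Fin n))
    (hf : f ∈ nicholsIdeal g χ) : comulT g χ f = 0 := by
  refine nicholsIdeal_induction g χ (p := fun f => comulT g χ f = 0) ?_ ?_ ?_ hf
  · intro I hI f hf
    rw [comulT_eq]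
    have hle : LinearMap.range ((I.restrictScalars k).subtype.rTensor (FreeAlgebra k (Fin n))) ⊔
        LinearMap.range ((I.restrictScalars k).subtype.lTensor (FreeAlgebra k (Fin n))) ≤
        LinearMap.ker (bosT g χ) := by
      refine sup_le ?_ ?_
      · rintro _ ⟨y, rfl⟩
        induction y with
        | zero => simp
        | add y z hy hz => rw [map_add]; exact add_mem hy hz
        | tmul a b =>
          rw [LinearMap.mem_ker, LinearMap.rTensor_tmul, bosT_tmul]
          rw [Submodule.subtype_apply, toNichols_eq_zero g χ (le_nicholsIdeal hI a.2)]
          simp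
      · rintro _ ⟨y, rfl⟩
        induction y with
        | zero => simp
        | add y z hy hz => rw [map_add]; exact add_mem hy hz
        | tmul a b =>
          rw [LinearMap.mem_ker, LinearMap.lTensor_tmul, bosT_tmul]
          rw [Submodule.subtype_apply, coactT_eq_zero g χ hI b.2, mul_zero]
    exact hle (hI.comul_mem f hf)
  · simp
  · intro f f' h h'
    rw [map_add, h, h', add_zero]

/-- The comultiplication of `H`: `Δ(a) = a ⊗ a` for `a ∈ G`, `Δ(xᵢ) = gᵢ ⊗ xᵢ + xᵢ ⊗ 1`. -/
def bosComul (g : Fin n → G) (χ : Fin n → G →* kˣ) : Bos g χ →ₐ[k] Bos g χ ⊗[k] Bos g χ :=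
  Bos.lift g χ (Nichols.lift g χ (comulT g χ) (comulT_eq_zero g χ))
    { toFun := fun a => ofG g χ a ⊗ₜ[k] ofG g χ a
      map_one' := by rw [map_one, Algebra.TensorProduct.one_def]
      map_mul' := fun a b => by rw [map_mul, Algebra.TensorProduct.tmul_mul_tmul] } (by
    intro a i
    have hc : ofG g χ a * ofG g χ (g i) = ofG g χ (g i) * ofG g χ a := by
      rw [← map_mul, ← map_mul, mul_comm]
    simp only [Nichols.lift_toNichols, comulT, FreeAlgebra.lift_ι_apply, MonoidHom.coe_mk,
      OneHom.coe_mk, mul_add, add_mul, Algebra.TensorProduct.tmul_mul_tmul, ofG_mul_genX, hc,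
      mul_one, one_mul, smul_add, TensorProduct.tmul_smul, TensorProduct.smul_tmul'])

theorem bosComul_ofG (g : Fin n → G) (χ : Fin n → G →* kˣ) (a : G) :
    bosComul g χ (ofG g χ a) = ofG g χ a ⊗ₜ[k] ofG g χ a := by
  rw [bosComul, Bos.lift_ofG]
  rfl

theorem bosComul_genX (g : Fin n → G) (χ : Fin n → G →* kˣ) (i : Fin n) :
    bosComul g χ (genX g χ i) = ofG g χ (g i) ⊗ₜ[k] genX g χ i + genX g χ i ⊗ₜ[k] 1 := by
  rw [bosComul, genX, Bos.lift_ofNichols]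
  simp [comulT, genX]

theorem counitT_eq_zero (g : Fin n → G) (χ : Fin n → G →* kˣ) (f : FreeAlgebra k (Fin n))
    (hf : f ∈ nicholsIdeal g χ) : FreeAlgebra.lift k (fun _ => (0 : k)) f = 0 := by
  refine nicholsIdeal_induction g χ
    (p := fun f => FreeAlgebra.lift k (fun _ => (0 : k)) f = 0) ?_ ?_ ?_ hf
  · intro I hI f hf
    have hle : (⨆ m : {m : ℕ // 2 ≤ m}, I.restrictScalars k ⊓ tDeg k n m) ≤
        LinearMap.ker (FreeAlgebra.lift k (fun _ : Fin n => (0 : k))).toLinearMap := by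
      refine iSup_le fun m => inf_le_right.trans ?_
      obtain ⟨m, hm⟩ := m
      obtain ⟨m, rfl⟩ : ∃ l, m = l + 1 := ⟨m - 1, by omega⟩
      rw [tDeg, pow_succ, Submodule.mul_le]
      intro a _ b hb
      have hb' : FreeAlgebra.lift k (fun _ : Fin n => (0 : k)) b = 0 := by
        induction hb using Submodule.span_induction with
        | mem x hx => obtain ⟨i, rfl⟩ := hx; simp
        | zero => simp
        | add x y _ _ hx hy => simp [hx, hy]
        | smul c x _ hx => simp [hx]
      simp [hb']
    exact hle (hI.homogeneous hf)
  · simp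
  · intro f f' h h'
    rw [map_add, h, h', add_zero]

/-- The counit of `H`: `ε(a) = 1` for `a ∈ G`, `ε(xᵢ) = 0`. -/
def bosCounit (g : Fin n → G) (χ : Fin n → G →* kˣ) : Bos g χ →ₐ[k] k :=
  Bos.lift g χ (Nichols.lift g χ (FreeAlgebra.lift k fun _ => 0) (counitT_eq_zero g χ)) 1
    (by intro a i; simp)

theorem bosCounit_ofG (g : Fin n → G) (χ : Fin n → G →* kˣ) (a : G) :
    bosCounit g χ (ofG g χ a) = 1 := by
  rw [bosCounit, Bos.lift_ofG]
  rfl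

theorem bosCounit_genX (g : Fin n → G) (χ : Fin n → G →* kˣ) (i : Fin n) :
    bosCounit g χ (genX g χ i) = 0 := by
  rw [bosCounit, genX, Bos.lift_ofNichols]
  simp

/-- The bialgebra structure of the bosonization `H = 𝔅(V) # kG`. -/
instance (g : Fin n → G) (χ : Fin n → G →* kˣ) : Bialgebra k (Bos g χ) :=
  Bialgebra.ofAlgHom (bosComul g χ) (bosCounit g χ)
    (Bos.algHom_ext (fun a => by simp [bosComul_ofG])
      (fun i => by
        simp [bosComul_genX, bosComul_ofG, TensorProduct.tmul_add, TensorProduct.add_tmul,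
          Algebra.TensorProduct.one_def, add_assoc]))
    (Bos.algHom_ext (fun a => by simp [bosComul_ofG, bosCounit_ofG])
      (fun i => by simp [bosComul_genX, bosCounit_ofG, bosCounit_genX]))
    (Bos.algHom_ext (fun a => by simp [bosComul_ofG, bosCounit_ofG])
      (fun i => by simp [bosComul_genX, bosCounit_genX]))

end Defs

section Frobenius

variable {k : Type*} [Field k] {A : Type*} [Ring A] [Bialgebra k A]

/-- `t` is a right integral of `A`: `t h = ε(h) t`. -/
def IsRightIntegral (t : A) : Prop :=
  ∀ h : A, t * h = Coalgebra.counit (R := k) h • t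

/-- `φ` is a right integral of the dual algebra `A*`: `φ ψ = ψ(1) φ` for all `ψ ∈ A*`, where the
product is `(φ ψ)(h) = φ(h₍₁₎) ψ(h₍₂₎)`. -/
def IsDualRightIntegral (φ : Module.Dual k A) : Prop :=
  ∀ (ψ : Module.Dual k A) (h : A),
    LinearMap.mul' k k (TensorProduct.map φ ψ (Coalgebra.comul h)) = ψ 1 * φ h

/-- `α` is the modular function of `A` determined by the right integral `t`: `a t = α(a) t`. -/
def IsModularFunction (t : A) (α : A →ₐ[k] k) : Prop :=
  ∀ a : A, a * t = α a • t

/-- `ρ` is the Nakayama automorphism for `φ`: `x φ = φ ρ(x)` in the bimodule `A*`, where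
`(x φ)(y) = φ(y x)` and `(φ x)(y) = φ(x y)`. -/
def IsNakayama (φ : Module.Dual k A) (ρ : A ≃ₐ[k] A) : Prop :=
  ∀ x y : A, φ (y * x) = φ (ρ x * y)

end Frobenius

section Graded

variable {k : Type*} [Field k] {A : Type*} [Ring A] [Algebra k A] {L : Type*} [Group L]

/-- `A` is the direct sum of the `𝒜 s`, and `𝒜 s 𝒜 t = 𝒜 (s t)` for all `s`, `t`. -/
def IsStronglyGraded [DecidableEq L] (𝒜 : L → Submodule k A) : Prop :=
  DirectSum.IsInternal 𝒜 ∧ ∀ s t : L, 𝒜 s * 𝒜 t = 𝒜 (s * t)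

/-- A (normalized) crossed system of the group `L` over the algebra `B`: a weak action of `L` on
`B` and a two-cocycle with invertible values. -/
structure CrossedSystem (k B L : Type*) [Field k] [Ring B] [Algebra k B] [Group L] where
  act : L → B →ₐ[k] B
  cocycle : L → L → Bˣ
  act_one : act 1 = AlgHom.id k B
  cocycle_one_left : ∀ s, cocycle 1 s = 1
  cocycle_one_right : ∀ s, cocycle s 1 = 1
  act_act : ∀ s t b, act s (act t b) * cocycle s t = cocycle s t * act (s * t) b
  cocycle_mul : ∀ r s t,
    act r (cocycle s t) * cocycle r (s * t) = (cocycle r s * cocycle (r * s) t : B)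

/-- The product of the crossed product `B ⋉ kL`, whose underlying space is the free left
`B`-module on `L`: `(a ⋉ s) (b ⋉ t) = a (s · b) σ(s, t) ⋉ s t`. -/
def CrossedSystem.mul {B : Type*} [Ring B] [Algebra k B] (S : CrossedSystem k B L)
    (u v : L →₀ B) : L →₀ B :=
  u.sum fun s a => v.sum fun t b => Finsupp.single (s * t) (a * S.act s b * S.cocycle s t)

/-- The algebra `A` with components `𝒜 s` and neutral component `B = 𝒜 1` is a crossed product
`B ⋉ kL`: it is isomorphic to such an algebra, by an isomorphism that is the identity on `B` and
respects the `L`-degrees. -/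
def IsCrossedProduct (B : Subalgebra k A) (𝒜 : L → Submodule k A) : Prop :=
  ∃ (S : CrossedSystem k B L) (e : (L →₀ B) ≃ₗ[k] A),
    (∀ b : B, e (Finsupp.single 1 b) = b) ∧
    (∀ (s : L) (b : B), e (Finsupp.single s b) ∈ 𝒜 s) ∧
    ∀ u v : L →₀ B, e (S.mul u v) = e u * e v

/-- The eigenspace `{h | ρ(h) = ω h}`. -/
def eigen (ρ : A ≃ₐ[k] A) (ω : kˣ) : Submodule k A :=
  Module.End.eigenspace ρ.toLinearMap (ω : k)

/-- The subalgebra `{h | ρ(h) = h}`. -/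
def fixed (ρ : A ≃ₐ[k] A) : Subalgebra k A :=
  AlgHom.equalizer (ρ : A →ₐ[k] A) (AlgHom.id k A)

end Graded

section Groups

variable {k : Type*} [Field k] {G : Type*} [CommGroup G] {n : ℕ}
  {g : Fin n → G} {χ : Fin n → G →* kˣ}

/-- The subgroup `L₂ = α(G)` of `kˣ`. -/
def L₂ (α : Bos g χ →ₐ[k] k) : Subgroup kˣ :=
  ((α : Bos g χ →* k).comp (ofG g χ)).toHomUnits.range

/-- The subgroup `L₁` of `kˣ` generated by the `qᵢᵢ = χᵢ(gᵢ)` and `α(G)`. -/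
def L₁ (α : Bos g χ →ₐ[k] k) : Subgroup kˣ :=
  Subgroup.closure (Set.range (fun i => χ i (g i)) ∪ L₂ α)

end Groups

end NicholsDiag

end

open scoped TensorProduct

noncomputable section

/-! The point is that `ρ` is diagonal on generators: `ρ(a) = α(a)⁻¹ a` for `a ∈ G` (`ofG_mem_eigen`)
and `ρ(xᵢ) = α(gᵢ)⁻¹ qᵢᵢ⁻¹ xᵢ` (`genX_mem_eigen`). Hence `H` is the sum of the eigenspaces with
eigenvalue in `L₁`.

To compute `ρ`, the Galois map `β(x ⊗ y) = x₍₁₎ ⊗ x₍₂₎ y` plays the role of an antipode. Its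
surjectivity makes `φ` nondegenerate (`radical_eq_bot`), and with `φ(h₍₁₎) h₍₂₎ = φ(h) 1` it
determines `Δ(ρ(a))` and `Δ(ρ(xᵢ))`. Applying `ε ⊗ id` gives `ρ` up to the scalars `ε(ρ(a))` and
`ε(ρ(xᵢ))`. The first is `α(a)⁻¹` because `α ∘ ρ = ε`, the second is `0` because `xᵢ` is nilpotent.

For the equivalence, let `π : H → kG` kill the `xᵢ`. It carries `ρ` to `a ↦ α(a)⁻¹ a`, so it kills
`H_ω` for `ω ∉ L₂`, while strong grading puts `1` in `H_ω H_{ω⁻¹}`; so `L₁ = L₂`. Then every `H_ω`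
contains some `a ∈ G`, a unit, and units in all degrees yield a crossed product, which is strongly
graded because its cocycle is invertible. -/

namespace NicholsDiag

/-! ### Contracting tensors with a linear form -/

section Contraction

variable {k : Type*} [Field k] {A : Type*} [Ring A] [Algebra k A]

/-- The map `ψ ⊗ id : A ⊗ A → A`. -/
def contract (ψ : Module.Dual k A) : A ⊗[k] A →ₗ[k] A :=
  (TensorProduct.lid k A).toLinearMap ∘ₗ ψ.rTensor A

@[simp]
theorem contract_tmul (ψ : Module.Dual k A) (x y : A) : contract ψ (x ⊗ₜ[k] y) = ψ x • y := by
  simp [contract]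

theorem contract_mul_one_tmul (ψ : Module.Dual k A) (u : A ⊗[k] A) (y : A) :
    contract ψ (u * (1 ⊗ₜ[k] y)) = contract ψ u * y := by
  induction u with
  | zero => simp
  | add u v hu hv => simp only [add_mul, map_add, hu, hv]
  | tmul a b => simp

theorem contract_mul_tmul (ψ : Module.Dual k A) (u : A ⊗[k] A) (x y : A) :
    contract ψ (u * (x ⊗ₜ[k] y)) = contract (ψ ∘ₗ LinearMap.mulRight k x) u * y := by
  induction u with
  | zero => simp
  | add u v hu hv => simp only [add_mul, map_add, hu, hv]
  | tmul a b => simp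

/-- The radical `{z | φ(z A) = 0}` of a linear form. -/
def radical (φ : Module.Dual k A) : Submodule k A :=
  LinearMap.ker ((LinearMap.mul k A).compr₂ φ)

theorem mem_radical {φ : Module.Dual k A} {z : A} :
    z ∈ radical φ ↔ ∀ y, φ (z * y) = 0 := by
  rw [radical, LinearMap.mem_ker, LinearMap.ext_iff]
  rfl

theorem mul_mem_radical {φ : Module.Dual k A} {z : A} (hz : z ∈ radical φ) (y : A) :
    z * y ∈ radical φ :=
  mem_radical.2 fun x => by rw [mul_assoc]; exact mem_radical.1 hz _

/-- Membership in `radical φ ⊗ A` becomes a family of equations. For the converse, `u` is expanded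
along a basis of the second factor, whose independence separates the coefficients. -/
theorem mem_radical_tensor {φ : Module.Dual k A} {u : A ⊗[k] A} :
    u ∈ LinearMap.range ((radical φ).subtype.rTensor A) ↔
      ∀ y, contract φ (u * (y ⊗ₜ[k] 1)) = 0 := by
  constructor
  · rintro ⟨w, rfl⟩ y
    induction w with
    | zero => simp
    | add u v hu hv => simp only [add_mul, map_add, hu, hv, add_zero]
    | tmul a b => simp [mem_radical.1 a.2 y]
  · intro h
    obtain ⟨c, rfl⟩ := TensorProduct.eq_repr_basis_right (Module.Basis.ofVectorSpace k A) u
    refine Submodule.sum_mem _ fun i hi => ?_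
    refine ⟨⟨c i, mem_radical.2 fun y => ?_⟩ ⊗ₜ _, rfl⟩
    have := h y
    rw [Finsupp.sum, Finset.sum_mul, map_sum] at this
    simp only [Algebra.TensorProduct.tmul_mul_tmul, contract_tmul, mul_one] at this
    exact (linearIndependent_iff'.1 (Module.Basis.ofVectorSpace k A).linearIndependent) _ _ this i hi

theorem eq_of_contract_eq {φ : Module.Dual k A} (hφ : radical φ = ⊥) {u v : A ⊗[k] A}
    (h : ∀ y, contract φ (u * (y ⊗ₜ[k] 1)) = contract φ (v * (y ⊗ₜ[k] 1))) : u = v := by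
  have : u - v ∈ LinearMap.range ((radical φ).subtype.rTensor A) :=
    mem_radical_tensor.2 fun y => by rw [sub_mul, map_sub, h, sub_self]
  obtain ⟨w, hw⟩ := this
  have h0 : (radical φ).subtype = 0 := by
    ext z
    exact (Submodule.mem_bot k).1 (hφ.le z.2)
  rw [h0] at hw
  simpa [eq_comm, sub_eq_zero] using hw

end Contraction

/-! ### Dual integrals: nondegeneracy and the Nakayama automorphism -/

section DualIntegral

variable {k : Type*} [Field k] {A : Type*} [Ring A] [Bialgebra k A]

/-- The Galois map `x ⊗ y ↦ x₍₁₎ ⊗ x₍₂₎ y` of a bialgebra. -/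
def galoisMap (k A : Type*) [Field k] [Ring A] [Bialgebra k A] : A ⊗[k] A →ₗ[k] A ⊗[k] A :=
  LinearMap.mul' k (A ⊗[k] A) ∘ₗ
    TensorProduct.map Coalgebra.comul Algebra.TensorProduct.includeRight.toLinearMap

@[simp]
theorem galoisMap_tmul (x y : A) :
    galoisMap k A (x ⊗ₜ[k] y) = Coalgebra.comul (R := k) x * (1 ⊗ₜ[k] y) :=
  rfl

theorem contract_counit_comul (x : A) :
    contract (Coalgebra.counit (R := k)) (Coalgebra.comul (R := k) x) = x := by
  simp [contract]

theorem contract_counit_galoisMap (w : A ⊗[k] A) :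
    contract (Coalgebra.counit (R := k)) (galoisMap k A w) = LinearMap.mul' k A w := by
  induction w with
  | zero => simp
  | add u v hu hv => simp only [map_add, hu, hv]
  | tmul a b => rw [galoisMap_tmul, contract_mul_one_tmul, contract_counit_comul]; rfl

/-- Every `ψ` takes the same value on both sides, by the definition of the product `φ ψ`, and linear
forms separate points. -/
theorem IsDualRightIntegral.contract_comul {φ : Module.Dual k A} (hφ : IsDualRightIntegral φ)
    (h : A) : contract φ (Coalgebra.comul h) = φ h • (1 : A) := by
  rw [← sub_eq_zero, ← Module.forall_dual_apply_eq_zero_iff k]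
  intro ψ
  have key : ∀ u : A ⊗[k] A, ψ (contract φ u) =
      LinearMap.mul' k k (TensorProduct.map φ ψ u) := by
    intro u
    induction u with
    | zero => simp
    | add u v hu hv => simp only [map_add, hu, hv]
    | tmul a b => simp
  rw [map_sub, key, hφ ψ h, map_smul, smul_eq_mul, mul_comm, sub_self]

/-- In Sweedler notation, `φ(h₍₁₎x₍₁₎) h₍₂₎x₍₂₎ y = φ(hx) y`. When `β(w) = y ⊗ 1`, this evaluates
the contraction of `Δ(h)(y ⊗ 1)`. -/
theorem IsDualRightIntegral.contract_comul_mul {φ : Module.Dual k A}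
    (hφ : IsDualRightIntegral φ) (h : A) (w : A ⊗[k] A) :
    contract φ (Coalgebra.comul h * galoisMap k A w) =
      contract (φ ∘ₗ LinearMap.mulLeft k h) w := by
  induction w with
  | zero => simp
  | add u v hu hv => simp only [map_add, mul_add, hu, hv]
  | tmul a b =>
    rw [galoisMap_tmul, ← mul_assoc, ← Bialgebra.comul_mul, contract_mul_one_tmul,
      hφ.contract_comul]
    simp

/-- A nonzero right integral of the dual of a finite-dimensional bialgebra with surjective Galois
map is a nondegenerate form. -/
theorem IsDualRightIntegral.radical_eq_bot [Module.Finite k A]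
    (hA : Function.Surjective (galoisMap k A)) {φ : Module.Dual k A}
    (hφ : IsDualRightIntegral φ) (hφ0 : φ ≠ 0) : radical φ = ⊥ := by
  set M := LinearMap.range ((radical φ).subtype.rTensor A) with hM
  -- The radical `R` is a right coideal: by surjectivity each test element `y ⊗ 1` is some `β(w)`,
  -- and `φ(z ·) = 0`.
  have hcomul : ∀ z ∈ radical φ, Coalgebra.comul (R := k) z ∈ M := by
    intro z hz
    refine mem_radical_tensor.2 fun y => ?_
    obtain ⟨w, hw⟩ := hA (y ⊗ₜ 1)
    rw [← hw, hφ.contract_comul_mul]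
    have : φ ∘ₗ LinearMap.mulLeft k z = 0 := by
      ext y
      exact mem_radical.1 hz y
    simp [this, contract]
  have hmap : M.map (galoisMap k A) ≤ M := by
    rw [Submodule.map_le_iff_le_comap]
    rintro _ ⟨w, rfl⟩
    induction w with
    | zero => simp
    | add u v hu hv => rw [map_add]; exact add_mem hu hv
    | tmul z y =>
      refine mem_radical_tensor.2 fun x => ?_
      have := mem_radical_tensor.1 (hcomul z z.2) x
      rw [LinearMap.rTensor_tmul, galoisMap_tmul, mul_assoc,
        Algebra.TensorProduct.tmul_mul_tmul, one_mul, mul_one, contract_mul_tmul]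
      rw [contract_mul_tmul, mul_one] at this
      rw [Submodule.subtype_apply, this, zero_mul]
  have hinj : Function.Injective (galoisMap k A) := LinearMap.injective_iff_surjective.2 hA
  -- The Galois map is injective by finite dimension, so `β(R ⊗ A) ⊆ R ⊗ A` is an equality.
  have hmapM : M.map (galoisMap k A) = M :=
    Submodule.eq_of_le_of_finrank_eq hmap
      (LinearEquiv.finrank_eq (Submodule.equivMapOfInjective _ hinj M)).symm
  -- Write `z ⊗ 1 = β(w)` with `w ∈ R ⊗ A`. Applying `ε ⊗ id` shows that `ε(z) 1` is the product of
  -- `w`, which lies in the right ideal `R`. If `ε(z) ≠ 0`, then `1 ∈ R` and `φ = 0`.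
  have hcounit : ∀ z ∈ radical φ, Coalgebra.counit (R := k) z = 0 := by
    intro z hz
    have hz1 : z ⊗ₜ[k] (1 : A) ∈ M.map (galoisMap k A) := by
      rw [hmapM]
      exact ⟨(⟨z, hz⟩ : radical φ) ⊗ₜ 1, rfl⟩
    obtain ⟨_, ⟨w, rfl⟩, hw⟩ := hz1
    have hmem : LinearMap.mul' k A ((radical φ).subtype.rTensor A w) ∈ radical φ := by
      clear hw
      induction w with
      | zero => simp
      | add u v hu hv => simp only [map_add]; exact add_mem hu hv
      | tmul z y => exact mul_mem_radical z.2 y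
    rw [← contract_counit_galoisMap, hw, contract_tmul] at hmem
    by_contra h0
    have h1 : (1 : A) ∈ radical φ := by
      have := (radical φ).smul_mem (Coalgebra.counit (R := k) z)⁻¹ hmem
      rwa [smul_smul, inv_mul_cancel₀ h0, one_smul] at this
    exact hφ0 (LinearMap.ext fun y => by simpa using mem_radical.1 h1 y)
  rw [eq_bot_iff]
  intro z hz
  obtain ⟨w, hw⟩ := hcomul z hz
  -- Since `Δ(z) ∈ R ⊗ A` and `ε` kills `R`, the counit axiom gives `z = 0`.
  have h0 : contract (Coalgebra.counit (R := k)) ((radical φ).subtype.rTensor A w) = 0 := by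
    clear hw
    induction w with
    | zero => simp
    | add u v hu hv => simp only [map_add, hu, hv, add_zero]
    | tmul z y => simp [hcounit z z.2]
  rw [hw, contract_counit_comul] at h0
  exact h0

/-- Here `Δ(x)(a ⊗ y) = Δ(xa)(1 ⊗ by)`, and `φ` contracts `Δ(xa)` to `φ(xa) 1`. -/
theorem IsDualRightIntegral.contract_mulRight_galoisMap {φ : Module.Dual k A}
    (hφ : IsDualRightIntegral φ) {a b : A} (ha : Coalgebra.comul (R := k) a = a ⊗ₜ a)
    (hab : a * b = 1) (w : A ⊗[k] A) :
    contract (φ ∘ₗ LinearMap.mulRight k a) (galoisMap k A w) =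
      b * contract (φ ∘ₗ LinearMap.mulRight k a) w := by
  induction w with
  | zero => simp
  | add u v hu hv => simp only [map_add, mul_add, hu, hv]
  | tmul x y =>
    have h1 : Coalgebra.comul (R := k) x * (a ⊗ₜ[k] y) =
        Coalgebra.comul (R := k) (x * a) * (1 ⊗ₜ[k] (b * y)) := by
      rw [Bialgebra.comul_mul, ha, mul_assoc, Algebra.TensorProduct.tmul_mul_tmul, mul_one,
        ← mul_assoc a, hab, one_mul]
    rw [galoisMap_tmul, contract_mul_one_tmul, ← contract_mul_tmul, h1, contract_mul_one_tmul,
      hφ.contract_comul]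
    simp

theorem IsDualRightIntegral.contract_mulRight_eq {φ : Module.Dual k A}
    (hφ : IsDualRightIntegral φ) {a b : A} (ha : Coalgebra.comul (R := k) a = a ⊗ₜ a)
    (hab : a * b = 1) {h : A} {w : A ⊗[k] A} (hw : galoisMap k A w = h ⊗ₜ 1) :
    contract (φ ∘ₗ LinearMap.mulRight k a) w = φ (h * a) • a := by
  have h1 := hφ.contract_mulRight_galoisMap ha hab w
  rw [hw, contract_tmul] at h1
  have h2 := congr(a * $h1)
  rw [← mul_assoc, hab, one_mul, mul_smul_comm, mul_one] at h2
  exact h2.symm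

/-- The Nakayama automorphism multiplies invertible group-like elements by scalars. -/
theorem IsDualRightIntegral.eq_smul_of_groupLike (hA : Function.Surjective (galoisMap k A))
    {φ : Module.Dual k A} (hφ : IsDualRightIntegral φ) (hφ0 : radical φ = ⊥) {a b r : A}
    (ha : Coalgebra.comul (R := k) a = a ⊗ₜ a) (hab : a * b = 1)
    (hr : ∀ y, φ (y * a) = φ (r * y)) : r = Coalgebra.counit (R := k) r • a := by
  -- By nondegeneracy, it suffices to test against `y ⊗ 1 = β(w)`; both contractions are `φ(ya) a`.
  have hc : Coalgebra.comul (R := k) r = r ⊗ₜ[k] a := by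
    refine eq_of_contract_eq hφ0 fun y => ?_
    obtain ⟨w, hw⟩ := hA (y ⊗ₜ 1)
    have e : φ ∘ₗ LinearMap.mulLeft k r = φ ∘ₗ LinearMap.mulRight k a := by
      ext y
      exact (hr y).symm
    rw [← hw, hφ.contract_comul_mul, e, hφ.contract_mulRight_eq ha hab hw, hw, hr]
    simp
  have := contract_counit_comul (k := k) r
  rw [hc, contract_tmul] at this
  exact this.symm

/-- The group-like argument with a correction: `Δ(u)(x ⊗ 1) = Δ(ux) - Δ(ua)(1 ⊗ bx)`. -/
theorem IsDualRightIntegral.contract_mulRight_galoisMap_skew {φ : Module.Dual k A}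
    (hφ : IsDualRightIntegral φ) {a b x : A} (ha : Coalgebra.comul (R := k) a = a ⊗ₜ a)
    (hab : a * b = 1) (hx : Coalgebra.comul (R := k) x = a ⊗ₜ x + x ⊗ₜ 1) (w : A ⊗[k] A) :
    contract (φ ∘ₗ LinearMap.mulRight k x) (galoisMap k A w) =
      contract (φ ∘ₗ LinearMap.mulRight k x) w -
        b * x * contract (φ ∘ₗ LinearMap.mulRight k a) w := by
  induction w with
  | zero => simp
  | add u v hu hv => simp only [map_add, mul_add, hu, hv]; abel
  | tmul u y =>
    have h1 : Coalgebra.comul (R := k) u * (x ⊗ₜ[k] y) =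
        Coalgebra.comul (R := k) (u * x) * (1 ⊗ₜ[k] y) -
          Coalgebra.comul (R := k) (u * a) * (1 ⊗ₜ[k] (b * x * y)) := by
      rw [Bialgebra.comul_mul, Bialgebra.comul_mul, ha, hx, mul_assoc, mul_assoc, ← mul_sub,
        add_mul, Algebra.TensorProduct.tmul_mul_tmul, Algebra.TensorProduct.tmul_mul_tmul,
        Algebra.TensorProduct.tmul_mul_tmul, mul_one, mul_one, one_mul, ← mul_assoc a,
        ← mul_assoc a, hab, one_mul, add_sub_cancel_left]
    rw [galoisMap_tmul, contract_mul_one_tmul, ← contract_mul_tmul, h1, map_sub,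
      contract_mul_one_tmul, contract_mul_one_tmul, hφ.contract_comul, hφ.contract_comul]
    simp

/-- The value of the Nakayama automorphism on a skew-primitive element. -/
theorem IsDualRightIntegral.eq_of_skewPrimitive (hA : Function.Surjective (galoisMap k A))
    {φ : Module.Dual k A} (hφ : IsDualRightIntegral φ) (hφ0 : radical φ = ⊥) {a b x r s : A}
    (ha : Coalgebra.comul (R := k) a = a ⊗ₜ a) (hab : a * b = 1)
    (hx : Coalgebra.comul (R := k) x = a ⊗ₜ x + x ⊗ₜ 1)
    (hr : ∀ y, φ (y * a) = φ (r * y)) (hs : ∀ y, φ (y * x) = φ (s * y)) :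
    s = Coalgebra.counit (R := k) s • (1 : A) +
      Coalgebra.counit (R := k) r • (b * x * a) := by
  have hc : Coalgebra.comul (R := k) s = s ⊗ₜ[k] 1 + r ⊗ₜ[k] (b * x * a) := by
    refine eq_of_contract_eq hφ0 fun y => ?_
    obtain ⟨w, hw⟩ := hA (y ⊗ₜ 1)
    have e : φ ∘ₗ LinearMap.mulLeft k s = φ ∘ₗ LinearMap.mulRight k x := by
      ext y
      exact (hs y).symm
    have h1 := hφ.contract_mulRight_galoisMap_skew ha hab hx w
    rw [hφ.contract_mulRight_eq ha hab hw, hw, contract_tmul, eq_sub_iff_add_eq] at h1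
    rw [← hw, hφ.contract_comul_mul, e, ← h1, hw, hr]
    simp [add_mul, ← hs]
  have := contract_counit_comul (k := k) s
  rw [hc, map_add, contract_tmul, contract_tmul] at this
  exact this.symm

/-- A right integral is not annihilated by a nondegenerate linear form. -/
theorem IsRightIntegral.apply_ne_zero {φ : Module.Dual k A} (hφ0 : radical φ = ⊥) {t : A}
    (ht : IsRightIntegral (k := k) t) (ht0 : t ≠ 0) : φ t ≠ 0 := by
  intro h
  have : t ∈ radical φ := mem_radical.2 fun y => by rw [ht y, map_smul, h, smul_zero]
  rw [hφ0] at this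
  exact ht0 this

/-- Compare `φ(tx) = ε(x) φ(t)` with `φ(ρ(x)t) = α(ρ(x)) φ(t)` and cancel `φ(t) ≠ 0`. -/
theorem IsModularFunction.apply_nakayama {φ : Module.Dual k A} (hφ0 : radical φ = ⊥)
    {ρ : A ≃ₐ[k] A} (hρ : IsNakayama φ ρ) {t : A} (ht : IsRightIntegral (k := k) t)
    (ht0 : t ≠ 0) {α : A →ₐ[k] k} (hα : IsModularFunction t α) (x : A) :
    α (ρ x) = Coalgebra.counit (R := k) x := by
  have h := hρ x t
  rw [ht x, hα, map_smul, map_smul, smul_eq_mul, smul_eq_mul] at h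
  exact (mul_right_cancel₀ (ht.apply_ne_zero hφ0 ht0) h).symm

end DualIntegral

/-! ### Eigenspace gradings and crossed products -/

section CrossedProducts

variable {k : Type*} [Field k] {A : Type*} [Ring A] [Algebra k A]

theorem mem_eigen {ρ : A ≃ₐ[k] A} {ω : kˣ} {x : A} : x ∈ eigen ρ ω ↔ ρ x = (ω : k) • x :=
  Module.End.mem_eigenspace_iff

theorem mem_fixed {ρ : A ≃ₐ[k] A} {x : A} : x ∈ fixed ρ ↔ ρ x = x :=
  Iff.rfl

theorem mem_fixed_iff_mem_eigen {ρ : A ≃ₐ[k] A} {x : A} : x ∈ fixed ρ ↔ x ∈ eigen ρ 1 := by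
  rw [mem_fixed, mem_eigen, Units.val_one, one_smul]

theorem mul_mem_eigen {ρ : A ≃ₐ[k] A} {ω τ : kˣ} {x y : A} (hx : x ∈ eigen ρ ω)
    (hy : y ∈ eigen ρ τ) : x * y ∈ eigen ρ (ω * τ) := by
  rw [mem_eigen] at *
  rw [map_mul, hx, hy, smul_mul_smul_comm, Units.val_mul]

theorem inv_mem_eigen {ρ : A ≃ₐ[k] A} {ω : kˣ} {u : Aˣ} (hu : (u : A) ∈ eigen ρ ω) :
    ((u⁻¹ : Aˣ) : A) ∈ eigen ρ ω⁻¹ := by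
  rw [mem_eigen] at *
  have h1 : ρ u * ρ (u⁻¹ : Aˣ) = 1 := by rw [← map_mul, Units.mul_inv, map_one]
  rw [hu, smul_mul_assoc] at h1
  have h2 := congr(((ω⁻¹ : kˣ) : k) • (((u⁻¹ : Aˣ) : A) * $h1))
  rw [mul_smul_comm, Units.inv_mul_cancel_left, smul_smul, Units.inv_mul, one_smul, mul_one] at h2
  exact h2

theorem iSupIndep_eigen (ρ : A ≃ₐ[k] A) (L : Subgroup kˣ) :
    iSupIndep fun ω : L => eigen ρ (ω : kˣ) :=
  (Module.End.eigenspaces_iSupIndep ρ.toLinearMap).comp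
    (f := fun ω : L => ((ω : kˣ) : k)) (Units.val_injective.comp Subtype.val_injective)

theorem mul_mem_iSup_eigen {ρ : A ≃ₐ[k] A} {L : Subgroup kˣ} {τ : kˣ} (hτ : τ ∈ L) {x y : A}
    (hx : x ∈ eigen ρ τ) (hy : y ∈ ⨆ ω : L, eigen ρ (ω : kˣ)) :
    x * y ∈ ⨆ ω : L, eigen ρ (ω : kˣ) := by
  induction hy using Submodule.iSup_induction' with
  | mem ω y hy =>
    have h := mul_mem_eigen hx hy
    exact Submodule.mem_iSup_of_mem (p := fun ω : L => eigen ρ (ω : kˣ))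
      ⟨τ * ω, mul_mem hτ ω.2⟩ h
  | zero => rw [mul_zero]; exact zero_mem _
  | add y z _ _ hy hz => rw [mul_add]; exact add_mem hy hz

/-- If every eigenspace of `ρ` to an element of `L` contains a unit, then the algebra is a crossed
product over the subalgebra of fixed points. -/
theorem isCrossedProduct_of_units {ρ : A ≃ₐ[k] A} {L : Subgroup kˣ} [DecidableEq L]
    (hint : DirectSum.IsInternal fun ω : L => eigen ρ (ω : kˣ)) (u : L → Aˣ) (hu1 : u 1 = 1)
    (hu : ∀ ω : L, (u ω : A) ∈ eigen ρ (ω : kˣ)) :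
    IsCrossedProduct (fixed ρ) fun ω : L => eigen ρ (ω : kˣ) := by
  classical
  have hact : ∀ (s : L) (b : fixed ρ), (u s : A) * b * (u s)⁻¹.val ∈ fixed ρ := by
    intro s b
    have := mul_mem_eigen (mul_mem_eigen (hu s) (mem_fixed_iff_mem_eigen.1 b.2))
      (inv_mem_eigen (hu s))
    rwa [mul_one, mul_inv_cancel, ← mem_fixed_iff_mem_eigen] at this
  have hcoc : ∀ s t : L, ((u s * u t * (u (s * t))⁻¹ : Aˣ) : A) ∈ fixed ρ := by
    intro s t
    have := mul_mem_eigen (mul_mem_eigen (hu s) (hu t)) (inv_mem_eigen (hu (s * t)))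
    rwa [Subgroup.coe_mul, mul_inv_cancel, ← mem_fixed_iff_mem_eigen, ← Units.val_mul,
      ← Units.val_mul] at this
  have hcoc' : ∀ s t : L, (((u s * u t * (u (s * t))⁻¹)⁻¹ : Aˣ) : A) ∈ fixed ρ := by
    intro s t
    have := inv_mem_eigen (mem_fixed_iff_mem_eigen.1 (hcoc s t))
    rwa [inv_one, ← mem_fixed_iff_mem_eigen] at this
  -- The action is conjugation by `u s`, the cocycle is `u s u t (u (s t))⁻¹`; normalization comes
  -- from `u 1 = 1`.
  let S : CrossedSystem k (fixed ρ) L :=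
    { act := fun s =>
        { toFun := fun b => ⟨(u s : A) * b * (u s)⁻¹.val, hact s b⟩
          map_one' := by ext; simp
          map_mul' := fun b c => by ext; simp [mul_assoc]
          map_zero' := by ext; simp
          map_add' := fun b c => by ext; simp [mul_add, add_mul]
          commutes' := fun r => by
            ext
            change (u s : A) * algebraMap k A r * (u s)⁻¹.val = algebraMap k A r
            rw [← Algebra.commutes, mul_assoc, Units.mul_inv, mul_one] }
      cocycle := fun s t =>
        ⟨⟨_, hcoc s t⟩, ⟨_, hcoc' s t⟩, Subtype.ext (Units.mul_inv (u s * u t * (u (s * t))⁻¹)),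
          Subtype.ext (Units.inv_mul (u s * u t * (u (s * t))⁻¹))⟩
      act_one := by ext b; simp [hu1]
      cocycle_one_left := fun s => by ext; simp [hu1]
      cocycle_one_right := fun s => by ext; simp [hu1]
      act_act := fun s t b => by ext; simp [mul_assoc]
      cocycle_mul := fun r s t => by ext; simp [mul_assoc] }
  let f : ∀ s : L, fixed ρ ≃ₗ[k] eigen ρ (s : kˣ) := fun s =>
    { toFun := fun b => ⟨(b : A) * u s, by
        have := mul_mem_eigen (mem_fixed_iff_mem_eigen.1 b.2) (hu s)
        rwa [one_mul] at this⟩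
      map_add' := fun b c => by ext; simp [add_mul]
      map_smul' := fun r b => by ext; simp
      invFun := fun x => ⟨(x : A) * (u s)⁻¹.val, by
        have := mul_mem_eigen x.2 (inv_mem_eigen (hu s))
        rwa [mul_inv_cancel, ← mem_fixed_iff_mem_eigen] at this⟩
      left_inv := fun b => by ext; simp
      right_inv := fun x => by ext; simp }
  -- This is `b ⋉ s ↦ b u s`, assembled from the bijections `f s` by directness of the sum.
  let e : (L →₀ fixed ρ) ≃ₗ[k] A :=
    (finsuppLequivDFinsupp k).trans ((DFinsupp.mapRange.linearEquiv f).trans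
      (LinearEquiv.ofBijective (DirectSum.coeLinearMap fun ω : L => eigen ρ (ω : kˣ)) hint))
  have he : ∀ (s : L) (b : fixed ρ), e (Finsupp.single s b) = (b : A) * u s := by
    intro s b
    simp only [e, LinearEquiv.trans_apply, finsuppLequivDFinsupp_apply_apply,
      Finsupp.toDFinsupp_single, DFinsupp.mapRange.linearEquiv_apply, DFinsupp.mapRange_single]
    exact DirectSum.coeLinearMap_of _ s _
  refine ⟨S, e, fun b => by rw [he, hu1, Units.val_one, mul_one], fun s b => ?_, fun v w => ?_⟩
  · rw [he]
    exact (f s b).2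
  · have hv : e v = v.sum fun s a => (a : A) * u s := by
      conv_lhs => rw [← Finsupp.sum_single v, Finsupp.sum, map_sum]
      simp only [he]
      rfl
    have hw : e w = w.sum fun s a => (a : A) * u s := by
      conv_lhs => rw [← Finsupp.sum_single w, Finsupp.sum, map_sum]
      simp only [he]
      rfl
    rw [hv, hw, CrossedSystem.mul]
    simp only [Finsupp.sum, map_sum, Finset.sum_mul, Finset.mul_sum, he]
    rw [Finset.sum_comm]
    refine Finset.sum_congr rfl fun s _ => Finset.sum_congr rfl fun t _ => ?_
    simp [S, mul_assoc]

/-- A crossed product is strongly graded. -/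
theorem IsCrossedProduct.isStronglyGraded {ρ : A ≃ₐ[k] A} {L : Subgroup kˣ} [DecidableEq L]
    (hint : DirectSum.IsInternal fun ω : L => eigen ρ (ω : kˣ))
    (h : IsCrossedProduct (fixed ρ) fun ω : L => eigen ρ (ω : kˣ)) :
    IsStronglyGraded fun ω : L => eigen ρ (ω : kˣ) := by
  obtain ⟨S, e, -, hmem, hmul⟩ := h
  refine ⟨hint, fun s t => le_antisymm ?_ ?_⟩
  · rw [Submodule.mul_le]
    intro x hx y hy
    exact mul_mem_eigen hx hy
  intro x hx
  obtain ⟨v, rfl⟩ := e.surjective x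
  -- As `e` respects degrees and the sum is direct, an element of degree `s t` comes from a family
  -- supported at `s t`.
  have hv : v = Finsupp.single (s * t) (v (s * t)) := by
    let w : DirectSum L fun ω => eigen ρ (ω : kˣ) :=
      DFinsupp.mapRange (fun ω (b : fixed ρ) => (⟨e (Finsupp.single ω b), hmem ω b⟩ :
        eigen ρ (ω : kˣ))) (fun ω => by ext; simp) v.toDFinsupp
    have hw : DirectSum.coeLinearMap (fun ω : L => eigen ρ (ω : kˣ)) w = e v := by
      have : ∀ v : L →₀ fixed ρ, DirectSum.coeLinearMap (fun ω : L => eigen ρ (ω : kˣ))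
          (DFinsupp.mapRange (fun ω (b : fixed ρ) => (⟨e (Finsupp.single ω b), hmem ω b⟩ :
            eigen ρ (ω : kˣ))) (fun ω => by ext; simp) v.toDFinsupp) = e v := by
        intro v
        induction v using Finsupp.induction_linear with
        | zero => simp
        | add v v' hv hv' =>
          rw [map_add, ← hv, ← hv', ← map_add, Finsupp.toDFinsupp_add, DFinsupp.mapRange_add]
          intro ω b c
          ext
          simp
        | single ω b =>
          rw [Finsupp.toDFinsupp_single, DFinsupp.mapRange_single]
          exact DirectSum.coeLinearMap_of _ ω _
      exact this v
    have hw' : w = DirectSum.of (fun ω : L => eigen ρ (ω : kˣ)) (s * t) ⟨e v, hx⟩ := by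
      apply hint.injective
      exact hw.trans (DirectSum.coeAddMonoidHom_of (fun ω : L => eigen ρ (ω : kˣ)) (s * t)
        ⟨e v, hx⟩).symm
    ext1 ω
    by_cases hω : ω = s * t
    · rw [hω, Finsupp.single_eq_same]
    · rw [Finsupp.single_eq_of_ne hω]
      have h0 : w ω = 0 := by rw [hw', DirectSum.of_eq_of_ne _ _ _ hω]
      have h1 : e (Finsupp.single ω (v ω)) = 0 := congr(($h0 : A))
      rw [map_eq_zero_iff e e.injective, Finsupp.single_eq_zero] at h1
      exact h1
  -- Factorization `c ⋉ s t = (c σ(s, t)⁻¹ ⋉ s)(1 ⋉ t)`.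
  have key : S.mul (Finsupp.single s (v (s * t) * ((S.cocycle s t)⁻¹ : (fixed ρ)ˣ)))
      (Finsupp.single t 1) = v := by
    rw [CrossedSystem.mul, Finsupp.sum_single_index, Finsupp.sum_single_index, map_one, mul_one,
      Units.inv_mul_cancel_right, ← hv]
    · simp
    · simp
  rw [← key, hmul]
  exact Submodule.mul_mem_mul (hmem s _) (hmem t _)

end CrossedProducts

/-! ### Linearity of the Galois map -/

section Galois

variable {k : Type*} [Field k] {A : Type*} [Ring A] [Bialgebra k A]

theorem galoisMap_mul_one_tmul (w : A ⊗[k] A) (y : A) :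
    galoisMap k A (w * (1 ⊗ₜ[k] y)) = galoisMap k A w * (1 ⊗ₜ[k] y) := by
  induction w with
  | zero => simp
  | add u v hu hv => simp only [add_mul, map_add, hu, hv]
  | tmul a b => simp [mul_assoc]

theorem galoisMap_tmul_one_mul (w : A ⊗[k] A) (x : A) :
    galoisMap k A ((x ⊗ₜ[k] 1) * w) = Coalgebra.comul (R := k) x * galoisMap k A w := by
  induction w with
  | zero => simp
  | add u v hu hv => simp only [mul_add, map_add, hu, hv]
  | tmul a b => simp [mul_assoc]

theorem galoisMap_surjective_of_tmul_one
    (h : ∀ x : A, x ⊗ₜ[k] (1 : A) ∈ LinearMap.range (galoisMap k A)) :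
    Function.Surjective (galoisMap k A) := by
  intro u
  induction u with
  | zero => exact ⟨0, map_zero _⟩
  | add u v hu hv =>
    obtain ⟨u, rfl⟩ := hu
    obtain ⟨v, rfl⟩ := hv
    exact ⟨u + v, map_add _ _ _⟩
  | tmul x y =>
    obtain ⟨w, hw⟩ := h x
    exact ⟨w * (1 ⊗ₜ[k] y), by rw [galoisMap_mul_one_tmul, hw]; simp⟩

end Galois

/-! ### Generators and the Galois map of the bosonization -/

section Bosonization

variable {k : Type*} [Field k] {G : Type*} [CommGroup G] {n : ℕ}
  {g : Fin n → G} {χ : Fin n → G →* kˣ}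

theorem comul_ofG (a : G) :
    Coalgebra.comul (R := k) (ofG g χ a) = ofG g χ a ⊗ₜ[k] ofG g χ a :=
  bosComul_ofG g χ a

theorem comul_genX (i : Fin n) : Coalgebra.comul (R := k) (genX g χ i) =
    ofG g χ (g i) ⊗ₜ[k] genX g χ i + genX g χ i ⊗ₜ[k] 1 :=
  bosComul_genX g χ i

theorem counit_ofG (a : G) : Coalgebra.counit (R := k) (ofG g χ a) = 1 :=
  bosCounit_ofG g χ a

theorem ofG_mul_ofG_inv (a : G) : ofG g χ a * ofG g χ a⁻¹ = 1 := by
  rw [← map_mul, mul_inv_cancel, map_one]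

theorem ofG_inv_mul_ofG (a : G) : ofG g χ a⁻¹ * ofG g χ a = 1 := by
  rw [← map_mul, inv_mul_cancel, map_one]

instance [Finite G] [Module.Finite k (Nichols g χ)] : Module.Finite k (Bos g χ) :=
  Module.Finite.equiv (SkewMonoidAlgebra.coeffLinearEquiv (S := k)).symm

/-- A subspace of `H` that contains `1` and is stable under left multiplication by the generators
is all of `H`. -/
theorem Bos.eq_top_of_mul_mem (P : Submodule k (Bos g χ)) (one : 1 ∈ P)
    (hG : ∀ a, ∀ h ∈ P, ofG g χ a * h ∈ P) (hx : ∀ i, ∀ h ∈ P, genX g χ i * h ∈ P) :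
    P = ⊤ := by
  have hN : ∀ f : FreeAlgebra k (Fin n), ∀ h ∈ P, ofNichols g χ (toNichols g χ f) * h ∈ P := by
    intro f
    induction f using FreeAlgebra.induction with
    | grade0 c =>
      intro h hh
      rw [AlgHom.commutes, AlgHom.commutes, ← Algebra.smul_def]
      exact P.smul_mem c hh
    | grade1 i => exact hx i
    | mul r s hr hs =>
      intro h hh
      rw [map_mul, map_mul, mul_assoc]
      exact hr _ (hs _ hh)
    | add r s hr hs =>
      intro h hh
      rw [map_add, map_add, add_mul]
      exact add_mem (hr _ hh) (hs _ hh)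
  rw [eq_top_iff]
  intro h _
  induction h using SkewMonoidAlgebra.induction with
  | h0 => exact zero_mem P
  | ha a r f _ _ hf =>
    refine add_mem ?_ (hf trivial)
    obtain ⟨r, rfl⟩ := toNichols_surjective g χ r
    rw [single_eq, ← mul_one (ofG g χ a)]
    exact hN r _ (hG a 1 one)

/-- The `h` with `h ⊗ 1` in the range are stable under left multiplication by the generators. For
`xᵢ`, this uses `xᵢh ⊗ 1 = Δ(xᵢ)(h ⊗ 1) - gᵢh ⊗ xᵢ`, where `gᵢh` is covered by the case of `G`. -/
theorem Bos.galoisMap_surjective : Function.Surjective (galoisMap k (Bos g χ)) := by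
  refine galoisMap_surjective_of_tmul_one fun x => ?_
  let P : Submodule k (Bos g χ) := (LinearMap.range (galoisMap k (Bos g χ))).comap
    (Algebra.TensorProduct.includeLeft (R := k) (S := k) (A := Bos g χ)
      (B := Bos g χ)).toLinearMap
  suffices P = ⊤ from (this.ge trivial : x ∈ P)
  have hG : ∀ a, ∀ h ∈ P, ofG g χ a * h ∈ P := by
    rintro a h ⟨w, hw⟩
    refine ⟨(ofG g χ a ⊗ₜ[k] 1) * w * (1 ⊗ₜ[k] ofG g χ a⁻¹), ?_⟩
    rw [galoisMap_mul_one_tmul, galoisMap_tmul_one_mul, hw, comul_ofG]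
    simp [ofG_mul_ofG_inv]
  refine Bos.eq_top_of_mul_mem P ⟨1, ?_⟩ hG ?_
  · simp [Algebra.TensorProduct.one_def]
  · intro i h hh
    obtain ⟨w, hw⟩ := hh
    obtain ⟨v, hv⟩ := hG (g i) h ⟨w, hw⟩
    refine ⟨(genX g χ i ⊗ₜ[k] 1) * w - v * (1 ⊗ₜ[k] genX g χ i), ?_⟩
    rw [map_sub, galoisMap_mul_one_tmul, galoisMap_tmul_one_mul, hw, hv, comul_genX]
    simp [add_mul]

end Bosonization

/-! ### Degree and nilpotency in the Nichols algebra -/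

section Nilpotent

variable {k : Type*} [Field k] {G : Type*} [CommGroup G] {n : ℕ}

/-- The algebra map `T(V) → 𝔅(V)[X]` with `xᵢ ↦ xᵢ X`, which records the degree. -/
def degT (g : Fin n → G) (χ : Fin n → G →* kˣ) :
    FreeAlgebra k (Fin n) →ₐ[k] Polynomial (Nichols g χ) :=
  FreeAlgebra.lift k fun i => Polynomial.monomial 1 (toNichols g χ (FreeAlgebra.ι k i))

theorem degT_eq_monomial (g : Fin n → G) (χ : Fin n → G →* kˣ) {m : ℕ}
    {f : FreeAlgebra k (Fin n)} (hf : f ∈ tDeg k n m) :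
    degT g χ f = Polynomial.monomial m (toNichols g χ f) := by
  induction m generalizing f with
  | zero =>
    rw [tDeg, pow_zero, Submodule.mem_one] at hf
    obtain ⟨c, rfl⟩ := hf
    rw [AlgHom.commutes, AlgHom.commutes]
    rfl
  | succ m ih =>
    rw [tDeg, pow_succ] at hf
    induction hf using Submodule.mul_induction_on' with
    | add x _ y _ hx hy => rw [map_add, map_add, map_add, hx, hy]
    | mem_mul_mem x hx y hy =>
      have hy' : degT g χ y = Polynomial.monomial 1 (toNichols g χ y) := by
        induction hy using Submodule.span_induction with
        | mem y hy => obtain ⟨i, rfl⟩ := hy; simp [degT]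
        | zero => simp
        | add x y _ _ hx hy => simp [hx, hy]
        | smul c x _ hx => rw [map_smul, map_smul, hx, Polynomial.smul_monomial]
      rw [map_mul, map_mul, ih hx, hy', Polynomial.monomial_mul_monomial]

theorem degT_eq_zero (g : Fin n → G) (χ : Fin n → G →* kˣ) (f : FreeAlgebra k (Fin n))
    (hf : f ∈ nicholsIdeal g χ) : degT g χ f = 0 := by
  refine nicholsIdeal_induction g χ (p := fun f => degT g χ f = 0) ?_ ?_ ?_ hf
  · intro I hI f hf
    have hle : (⨆ m : {m : ℕ // 2 ≤ m}, I.restrictScalars k ⊓ tDeg k n m) ≤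
        LinearMap.ker (degT g χ).toLinearMap := by
      refine iSup_le fun m f hf => ?_
      rw [LinearMap.mem_ker, AlgHom.toLinearMap_apply, degT_eq_monomial g χ hf.2,
        toNichols_eq_zero g χ (le_nicholsIdeal hI hf.1), Polynomial.monomial_zero_right]
    exact hle (hI.homogeneous hf)
  · simp
  · intro f f' h h'
    rw [map_add, h, h', add_zero]

/-- The generators of a finite-dimensional Nichols algebra are nilpotent. -/
theorem isNilpotent_genX (g : Fin n → G) (χ : Fin n → G →* kˣ) [Module.Finite k (Nichols g χ)]
    (i : Fin n) : IsNilpotent (genX g χ i) := by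
  set x := toNichols g χ (FreeAlgebra.ι k i)
  have hx : IsIntegral k x := Algebra.IsIntegral.isIntegral x
  have hd : Nichols.lift g χ (degT g χ) (degT_eq_zero g χ) x = Polynomial.monomial 1 x := by
    rw [Nichols.lift_toNichols, degT, FreeAlgebra.lift_ι_apply]
  -- The degree map sends `x` to `xX`, so `xX` is a root of the minimal polynomial of `x`. If that
  -- has degree `d`, the coefficient of `X^d` reads `x^d = 0`.
  have h0 : Polynomial.aeval (Polynomial.monomial 1 x) (minpoly k x) = 0 := by
    rw [← hd, Polynomial.aeval_algHom_apply, minpoly.aeval, map_zero]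
  have h1 := congr(Polynomial.coeff $h0 (minpoly k x).natDegree)
  rw [Polynomial.aeval_eq_sum_range, Polynomial.finsetSum_coeff, Finset.sum_range_succ,
    Finset.sum_eq_zero] at h1
  · simp only [Polynomial.monomial_pow, one_mul,
      Polynomial.coeff_monomial_same, Polynomial.coeff_natDegree, (minpoly.monic hx).leadingCoeff,
      one_smul, zero_add, Polynomial.coeff_zero] at h1
    exact ⟨_, by rw [genX, ← map_pow, h1, map_zero]⟩
  · intro j hj
    rw [Polynomial.monomial_pow, one_mul, Polynomial.coeff_smul,
      Polynomial.coeff_monomial_of_ne, smul_zero]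
    exact (Finset.mem_range.1 hj).ne'

end Nilpotent

/-! ### The Nakayama automorphism of the bosonization -/

section Nakayama

variable {k : Type*} [Field k] {G : Type*} [CommGroup G] {n : ℕ}
  {g : Fin n → G} {χ : Fin n → G →* kˣ}

/-- The restriction of the modular function to `G`. -/
def modularChar (α : Bos g χ →ₐ[k] k) : G →* kˣ :=
  ((α : Bos g χ →* k).comp (ofG g χ)).toHomUnits

theorem coe_modularChar (α : Bos g χ →ₐ[k] k) (a : G) :
    (modularChar α a : k) = α (ofG g χ a) :=
  rfl

theorem mem_L₂ {α : Bos g χ →ₐ[k] k} {ω : kˣ} : ω ∈ L₂ α ↔ ∃ a, modularChar α a = ω :=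
  Iff.rfl

theorem L₂_le_L₁ (α : Bos g χ →ₐ[k] k) : L₂ α ≤ L₁ α :=
  fun _ h => Subgroup.subset_closure (Or.inr h)

theorem modularChar_mem (α : Bos g χ →ₐ[k] k) (a : G) : modularChar α a ∈ L₁ α :=
  L₂_le_L₁ α ⟨a, rfl⟩

theorem q_mem (α : Bos g χ →ₐ[k] k) (i : Fin n) : χ i (g i) ∈ L₁ α :=
  Subgroup.subset_closure (Or.inl ⟨i, rfl⟩)

/-- The algebra map `H → kG` that is the identity on `G` and kills the `xᵢ`. -/
def toGroupAlgebra (g : Fin n → G) (χ : Fin n → G →* kˣ) : Bos g χ →ₐ[k] MonoidAlgebra k G :=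
  Bos.lift g χ ((Algebra.ofId k _).comp
    (Nichols.lift g χ (FreeAlgebra.lift k fun _ => 0) (counitT_eq_zero g χ)))
    (MonoidAlgebra.of k G) (by intro a i; simp)

theorem toGroupAlgebra_ofG (a : G) :
    toGroupAlgebra g χ (ofG g χ a) = MonoidAlgebra.single a 1 := by
  rw [toGroupAlgebra, Bos.lift_ofG, MonoidAlgebra.of_apply]

theorem toGroupAlgebra_genX (i : Fin n) : toGroupAlgebra g χ (genX g χ i) = 0 := by
  rw [toGroupAlgebra, genX, Bos.lift_ofNichols]
  simp

variable [Finite G] [Module.Finite k (Nichols g χ)] {φ : Module.Dual k (Bos g χ)}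
  {ρ : Bos g χ ≃ₐ[k] Bos g χ} {t : Bos g χ} {α : Bos g χ →ₐ[k] k}

/-- With `ρ(a) = ε(ρ(a)) a`, applying `α` gives `ε(ρ(a)) α(a) = α(ρ(a)) = ε(a) = 1`. -/
theorem counit_nakayama_ofG (hφ : IsDualRightIntegral φ) (hφ0 : φ ≠ 0) (hρ : IsNakayama φ ρ)
    (ht : IsRightIntegral (k := k) t) (ht0 : t ≠ 0) (hα : IsModularFunction t α) (a : G) :
    Coalgebra.counit (R := k) (ρ (ofG g χ a)) = ((modularChar α a)⁻¹ : kˣ) := by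
  have hφ1 := hφ.radical_eq_bot Bos.galoisMap_surjective hφ0
  have h1 := hφ.eq_smul_of_groupLike Bos.galoisMap_surjective hφ1 (comul_ofG a)
    (ofG_mul_ofG_inv a) (hρ (ofG g χ a))
  have h2 := hα.apply_nakayama hφ1 hρ ht ht0 (ofG g χ a)
  rw [h1, map_smul, ← coe_modularChar, counit_ofG, smul_eq_mul] at h2
  rw [← Units.mul_eq_one_iff_eq_inv, h2]

/-- The Nakayama automorphism multiplies `a ∈ G` by `α(a)⁻¹`. -/
theorem ofG_mem_eigen (hφ : IsDualRightIntegral φ) (hφ0 : φ ≠ 0) (hρ : IsNakayama φ ρ)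
    (ht : IsRightIntegral (k := k) t) (ht0 : t ≠ 0) (hα : IsModularFunction t α) (a : G) :
    ofG g χ a ∈ eigen ρ (modularChar α a)⁻¹ := by
  rw [mem_eigen, ← counit_nakayama_ofG hφ hφ0 hρ ht ht0 hα]
  exact hφ.eq_smul_of_groupLike Bos.galoisMap_surjective
    (hφ.radical_eq_bot Bos.galoisMap_surjective hφ0) (comul_ofG a) (ofG_mul_ofG_inv a)
    (hρ (ofG g χ a))

/-- The Nakayama automorphism multiplies `xᵢ` by `α(gᵢ)⁻¹ qᵢᵢ⁻¹`. -/
theorem genX_mem_eigen (hφ : IsDualRightIntegral φ) (hφ0 : φ ≠ 0) (hρ : IsNakayama φ ρ)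
    (ht : IsRightIntegral (k := k) t) (ht0 : t ≠ 0) (hα : IsModularFunction t α) (i : Fin n) :
    genX g χ i ∈ eigen ρ ((modularChar α (g i))⁻¹ * (χ i (g i))⁻¹) := by
  have h := hφ.eq_of_skewPrimitive Bos.galoisMap_surjective
    (hφ.radical_eq_bot Bos.galoisMap_surjective hφ0) (comul_ofG (g i)) (ofG_mul_ofG_inv (g i))
    (comul_genX i) (hρ (ofG g χ (g i))) (hρ (genX g χ i))
  -- The algebra map `ε ∘ ρ` sends the nilpotent `xᵢ` to a nilpotent element of a field.
  have h0 : Coalgebra.counit (R := k) (ρ (genX g χ i)) = 0 := by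
    have := (isNilpotent_genX g χ i).map
      ((Bialgebra.counitAlgHom k (Bos g χ)).comp (ρ : Bos g χ →ₐ[k] Bos g χ))
    exact this.eq_zero
  -- The factor `qᵢᵢ⁻¹` arises from `gᵢ⁻¹ xᵢ gᵢ = χᵢ(gᵢ)⁻¹ xᵢ`.
  rw [h0, zero_smul, zero_add, counit_nakayama_ofG hφ hφ0 hρ ht ht0 hα, ofG_mul_genX,
    smul_mul_assoc, mul_assoc, ofG_inv_mul_ofG, mul_one, smul_smul, map_inv] at h
  rw [mem_eigen, h, Units.val_mul]

/-- The sum of these eigenspaces contains `1` and is stable under left multiplication by the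
generators, which are eigenvectors with eigenvalue in `L₁`. -/
theorem isInternal_eigen (hφ : IsDualRightIntegral φ) (hφ0 : φ ≠ 0) (hρ : IsNakayama φ ρ)
    (ht : IsRightIntegral (k := k) t) (ht0 : t ≠ 0) (hα : IsModularFunction t α)
    [DecidableEq (L₁ α)] : DirectSum.IsInternal fun ω : L₁ α => eigen ρ (ω : kˣ) := by
  rw [DirectSum.isInternal_submodule_iff_iSupIndep_and_iSup_eq_top]
  refine ⟨iSupIndep_eigen ρ _, ?_⟩
  refine Bos.eq_top_of_mul_mem _ (Submodule.mem_iSup_of_mem 1 ?_) (fun a => ?_) fun i => ?_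
  · simp [mem_eigen]
  · intro h hh
    exact mul_mem_iSup_eigen (inv_mem (modularChar_mem α a))
      (ofG_mem_eigen hφ hφ0 hρ ht ht0 hα a) hh
  · intro h hh
    exact mul_mem_iSup_eigen (mul_mem (inv_mem (modularChar_mem α _)) (inv_mem (q_mem α i)))
      (genX_mem_eigen hφ hφ0 hρ ht ht0 hα i) hh

theorem toGroupAlgebra_nakayama (hφ : IsDualRightIntegral φ) (hφ0 : φ ≠ 0)
    (hρ : IsNakayama φ ρ) (ht : IsRightIntegral (k := k) t) (ht0 : t ≠ 0)
    (hα : IsModularFunction t α) (h : Bos g χ) (a : G) :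
    (toGroupAlgebra g χ (ρ h)).coeff a =
      ((modularChar α a)⁻¹ : kˣ) * (toGroupAlgebra g χ h).coeff a := by
  let P : Submodule k (Bos g χ) :=
    { carrier := {h | ∀ a, (toGroupAlgebra g χ (ρ h)).coeff a =
        ((modularChar α a)⁻¹ : kˣ) * (toGroupAlgebra g χ h).coeff a}
      zero_mem' := fun a => by simp
      add_mem' := fun {x y} hx hy a => by
        simp only [map_add, MonoidAlgebra.coeff_add, Finsupp.add_apply, hx a, hy a, mul_add]
      smul_mem' := fun c x hx a => by
        simp only [map_smul, MonoidAlgebra.coeff_smul, Finsupp.smul_apply, hx a, smul_eq_mul,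
          mul_left_comm] }
  suffices P = ⊤ from (this.ge trivial : h ∈ P) a
  refine Bos.eq_top_of_mul_mem P (fun a => ?_) (fun b h hh a => ?_) fun i h hh a => ?_
  · rw [map_one, map_one, MonoidAlgebra.one_def, MonoidAlgebra.coeff_single]
    by_cases ha : a = 1
    · simp [ha]
    · simp [Finsupp.single_eq_of_ne ha]
  -- The coefficient of `b h` at `a` is that of `h` at `b⁻¹ a`, and the scalars at `b` and `b⁻¹ a`
  -- multiply to `α(a)⁻¹`.
  · rw [map_mul, mem_eigen.1 (ofG_mem_eigen hφ hφ0 hρ ht ht0 hα b), smul_mul_assoc, map_smul,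
      map_mul, map_mul, toGroupAlgebra_ofG, MonoidAlgebra.coeff_smul, Finsupp.smul_apply,
      MonoidAlgebra.coeff_single_mul_apply, MonoidAlgebra.coeff_single_mul_apply, hh,
      one_mul, one_mul, smul_eq_mul, ← mul_assoc, ← Units.val_mul, ← mul_inv, ← map_mul,
      mul_inv_cancel_left]
  · rw [map_mul, mem_eigen.1 (genX_mem_eigen hφ hφ0 hρ ht ht0 hα i), smul_mul_assoc, map_smul,
      map_mul, map_mul, toGroupAlgebra_genX]
    simp

/-- Eigenvectors with eigenvalue outside `α(G)` are killed by the projection to `kG`. -/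
theorem toGroupAlgebra_eq_zero (hφ : IsDualRightIntegral φ) (hφ0 : φ ≠ 0)
    (hρ : IsNakayama φ ρ) (ht : IsRightIntegral (k := k) t) (ht0 : t ≠ 0)
    (hα : IsModularFunction t α) {ω : kˣ} (hω : ω ∉ L₂ α) {h : Bos g χ} (hh : h ∈ eigen ρ ω) :
    toGroupAlgebra g χ h = 0 := by
  ext a
  have h1 := toGroupAlgebra_nakayama hφ hφ0 hρ ht ht0 hα h a
  rw [mem_eigen.1 hh, map_smul, MonoidAlgebra.coeff_smul, Finsupp.smul_apply, smul_eq_mul] at h1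
  by_contra h0
  have h2 := Units.ext (mul_right_cancel₀ h0 h1)
  exact hω (h2 ▸ inv_mem (mem_L₂.2 ⟨a, rfl⟩))

theorem IsStronglyGraded.L₁_eq_L₂ (hφ : IsDualRightIntegral φ) (hφ0 : φ ≠ 0)
    (hρ : IsNakayama φ ρ) (ht : IsRightIntegral (k := k) t) (ht0 : t ≠ 0)
    (hα : IsModularFunction t α) [DecidableEq (L₁ α)]
    (h : IsStronglyGraded fun ω : L₁ α => eigen ρ (ω : kˣ)) : L₁ α = L₂ α := by
  refine le_antisymm (fun ω hω => ?_) (L₂_le_L₁ α)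
  by_contra h0
  have h1 : (1 : Bos g χ) ∈ eigen ρ ω * eigen ρ ω⁻¹ := by
    have := h.2 ⟨ω, hω⟩ ⟨ω, hω⟩⁻¹
    rw [mul_inv_cancel] at this
    refine this.ge ?_
    simp [mem_eigen]
  have hle : eigen ρ ω * eigen ρ ω⁻¹ ≤ LinearMap.ker (toGroupAlgebra g χ).toLinearMap := by
    rw [Submodule.mul_le]
    intro x hx y _
    rw [LinearMap.mem_ker, AlgHom.toLinearMap_apply, map_mul,
      toGroupAlgebra_eq_zero hφ hφ0 hρ ht ht0 hα h0 hx, zero_mul]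
  have h2 : toGroupAlgebra g χ 1 = 0 := hle h1
  rw [map_one] at h2
  exact one_ne_zero h2

end Nakayama

end NicholsDiag

end

/-! ### The equivalence -/

open NicholsDiag in
theorem mainTheorem2 {k : Type*} [Field k] {G : Type*} [CommGroup G] [Finite G] {n : ℕ}
    (g : Fin n → G) (χ : Fin n → G →* kˣ) [Module.Finite k (Nichols g χ)]
    (φ : Module.Dual k (Bos g χ)) (hφ : IsDualRightIntegral φ) (hφ0 : φ ≠ 0)
    (ρ : Bos g χ ≃ₐ[k] Bos g χ) (hρ : IsNakayama φ ρ)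
    (t : Bos g χ) (ht : IsRightIntegral (k := k) t) (ht0 : t ≠ 0)
    (α : Bos g χ →ₐ[k] k) (hα : IsModularFunction t α) :
    letI := Classical.decEq (L₁ α)
    DirectSum.IsInternal (fun ω : L₁ α => eigen ρ (ω : kˣ)) ∧
    List.TFAE [
      IsStronglyGraded (fun ω : L₁ α => eigen ρ (ω : kˣ)),
      L₁ α = L₂ α,
      ∀ ω : L₁ α, ∃ a : G, ofG g χ a ∈ eigen ρ (ω : kˣ),
      IsCrossedProduct (fixed ρ) (fun ω : L₁ α => eigen ρ (ω : kˣ))] := by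
  let := Classical.decEq (L₁ α)
  have hint := isInternal_eigen hφ hφ0 hρ ht ht0 hα
  refine ⟨hint, ?_⟩
  tfae_have 1 → 2 := fun h => h.L₁_eq_L₂ hφ hφ0 hρ ht ht0 hα
  tfae_have 2 → 3 := by
    intro h ω
    -- The inverse is needed because `a` has eigenvalue `α(a)⁻¹`.
    obtain ⟨a, ha⟩ := mem_L₂.1 (h ▸ inv_mem ω.2 : (ω : kˣ)⁻¹ ∈ L₂ α)
    refine ⟨a, ?_⟩
    rw [← inv_inv (ω : kˣ), ← ha]
    exact ofG_mem_eigen hφ hφ0 hρ ht ht0 hα a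
  tfae_have 3 → 4 := by
    intro h
    choose a ha using h
    let u : G → (Bos g χ)ˣ := fun a =>
      ⟨ofG g χ a, ofG g χ a⁻¹, ofG_mul_ofG_inv a, ofG_inv_mul_ofG a⟩
    -- The group element chosen in degree `1` need not be the identity, so it is replaced by `1` to
    -- normalize the cocycle.
    refine isCrossedProduct_of_units hint (Function.update (fun ω => u (a ω)) 1 1)
      (Function.update_self ..) fun ω => ?_
    by_cases hω : ω = 1
    · subst hω
      simp [mem_eigen]
    · rw [Function.update_of_ne hω]
      exact ha ω
  tfae_have 4 → 1 := fun h => h.isStronglyGraded hint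
  tfae_finish
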